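/- **Setting.** For a $\sigma$-finite measure space $(R,\mu)$, an *r.i. quasi-Banach function norm* over $(R,\mu)$ is a functional $\|\cdot\|_X$ with values in $[0,\infty]$ on the measurable functions on $R$ (functions equal a.e. are identified) such that $\|f\|_X=\|\,|f|\,\|_X$ and, on nonnegative measurable functions with values in $[0,\infty]$: $\|cf\|_X=c\|f\|_X$ for $c\in[0,\infty)$; $\|f\|_X=0$ iff $f=0$ a.e.; $\|f+g\|_X\le C(\|f\|_X+\|g\|_X)$ for some constant $C\ge 1$; $g\le f$ a.e. implies $\|g\|_X\le\|f\|_X$; $0\le f_n\uparrow f$ a.e. implies $\|f_n\|_X\uparrow\|f\|_X$; $\|\chi_E\|_X<\infty$ whenever $\mu(E)<\infty$; and $\|f\|_X=\|g\|_X$ whenever $f^*=g^*$, where $f^*(t)=\inf\{s\ge 0:\mu(\{|f|>s\})\le t\}$, $t\ge 0$, is the non-increasing rearrangement. The corresponding space is $X=\{f:\|f\|_X<\infty\}$ (real- or complex-valued functions). We write $X\hookrightarrow Y$ if $X\subseteq Y$ and the inclusion is continuous, i.e. $\|f\|_Y\le C\|f\|_X$ for all $f\in X$ with a constant $C$. Let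 $\|\cdot\|_A$, $\|\cdot\|_B$ be r.i. quasi-Banach function norms over $[0,\infty)$ with Lebesgue measure. The spaces $WL(A,B)$, $A\cap B$ and $A+B$ are given by $$\|f\|_{WL(A,B)}=\|f^*\chi_{[0,1]}\|_A+\|f^*\chi_{(1,\infty)}\|_B,\qquad \|f\|_{A\cap B}=\max\{\|f\|_A,\|f\|_B\},\qquad \|f\|_{A+B}=\inf_{f=g+h}\big(\|g\|_A+\|h\|_B\big).$$ The local component of $\|\cdot\|_A$ is *stronger* than that of $\|\cdot\|_B$ if, for every measurable $f$ on $[0,\infty)$, $\|f^*\chi_{[0,1]}\|_A<\infty$ implies $\|f^*\chi_{[0,1]}\|_B<\infty$. The global component of $\|\cdot\|_B$ is *stronger* than that of $\|\cdot\|_A$ if, for every measurable $f$ on $[0,\infty)$ with $f^*(1)<\infty$, $\|f^*\chi_{(1,\infty)}\|_B<\infty$ implies $\|f^*\chi_{(1,\infty)}\|_A<\infty$. **Theorem 2.1.** With $A$, $B$ as above, $$A\cap B\hookrightarrow WL(A,B)\hookrightarrow A+B .$$ If moreover the local component of $\|\cdot\|_A$ is stronger than that of $\|\cdot\|_B$ and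 the global component of $\|\cdot\|_B$ is stronger than that of $\|\cdot\|_A$, then $$A\cap B=WL(A,B),\qquad A+B=WL(B,A),$$ as sets and with equivalent quasinorms. The same holds over any $\sigma$-finite measure space $(R,\mu)$ in the following sense: if $\|\cdot\|_{A'}$, $\|\cdot\|_{B'}$ are r.i. quasi-Banach function norms over $(R,\mu)$ represented by $\|\cdot\|_A$, $\|\cdot\|_B$, that is, $\|f\|_{A'}=\|f^*\|_A$ and $\|f\|_{B'}=\|f^*\|_B$ for all measurable $f$ on $R$, then all the assertions above, under the same assumptions on $A$ and $B$, hold with $A'\cap B'$ and $A'+B'$ in place of $A\cap B$ and $A+B$, and with the spaces $WL(A,B)$, $WL(B,A)$ of functions on $R$ given by the same formulas, $f^*$ being the rearrangement of $f$ with respect to $\mu$. -/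

import Mathlib

open MeasureTheory Set Filter Topology
open scoped ENNReal NNReal

namespace WienerLuxemburg

noncomputable section

/-- The half-line `[0, ∞)` with Lebesgue measure. Functions on the half-line are functions on `ℝ`,
considered up to equality almost everywhere with respect to this measure. -/
def halfLine : Measure ℝ := (volume : Measure ℝ).restrict (Ici 0)

/-- The non-increasing rearrangement `f^*(t) = inf {s ≥ 0 : μ {f > s} ≤ t}`, `t ≥ 0`, of a
nonnegative extended-valued function `f` (the value `s = ∞` is always admissible, which is the
convention `inf ∅ = ∞`). Only arguments `t ≥ 0` are relevant. -/
def rearrangement {R : Type*} [MeasurableSpace R] (μ : Measure R) (f : R → ℝ≥0∞) (t : ℝ) : ℝ≥0∞ :=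
  sInf {s : ℝ≥0∞ | μ {x | s < f x} ≤ ENNReal.ofReal t}

/-- `ρ` is (the restriction to nonnegative functions of) a quasi-Banach function norm over `(R, μ)`;
the quasinorm of a scalar function `f` is `ρ |f|`. -/
structure IsQuasiBanachFunctionNorm {R : Type*} [MeasurableSpace R] (μ : Measure R)
    (ρ : (R → ℝ≥0∞) → ℝ≥0∞) : Prop where
  /-- positive homogeneity -/
  smul : ∀ (c : ℝ≥0) (f : R → ℝ≥0∞), AEMeasurable f μ → ρ (fun x => c * f x) = c * ρ f
  /-- definiteness -/
  eq_zero_iff : ∀ f : R → ℝ≥0∞, AEMeasurable f μ → (ρ f = 0 ↔ f =ᵐ[μ] 0)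
  /-- the triangle inequality up to a constant (the modulus of concavity) -/
  add_le : ∃ C : ℝ≥0, 1 ≤ C ∧ ∀ f g : R → ℝ≥0∞, AEMeasurable f μ → AEMeasurable g μ →
    ρ (fun x => f x + g x) ≤ C * (ρ f + ρ g)
  /-- the lattice property -/
  mono : ∀ f g : R → ℝ≥0∞, AEMeasurable f μ → AEMeasurable g μ → f ≤ᵐ[μ] g → ρ f ≤ ρ g
  /-- the Fatou property: `0 ≤ f n ↑ f` a.e. implies `ρ (f n) ↑ ρ f` -/
  fatou : ∀ (f : ℕ → R → ℝ≥0∞) (g : R → ℝ≥0∞), (∀ n, AEMeasurable (f n) μ) → AEMeasurable g μ →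
    (∀ᵐ x ∂μ, Monotone fun n => f n x) → (∀ᵐ x ∂μ, Tendsto (fun n => f n x) atTop (𝓝 (g x))) →
    Tendsto (fun n => ρ (f n)) atTop (𝓝 (ρ g))
  /-- characteristic functions of sets of finite measure have finite quasinorm -/
  indicator_lt_top : ∀ E : Set R, MeasurableSet E → μ E < ∞ → ρ (E.indicator fun _ => 1) < ∞

/-- A rearrangement-invariant quasi-Banach function norm. -/
structure IsRIQuasiBanachFunctionNorm {R : Type*} [MeasurableSpace R] (μ : Measure R)
    (ρ : (R → ℝ≥0∞) → ℝ≥0∞) : Prop extends IsQuasiBanachFunctionNorm μ ρ where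
  rearrangement_invariant : ∀ f g : R → ℝ≥0∞, AEMeasurable f μ → AEMeasurable g μ →
    rearrangement μ f = rearrangement μ g → ρ f = ρ g

/-- `ρ'`, over the half-line, represents `ρ`, over `(R, μ)`: `ρ f = ρ' (f^*)`, as in the Luxemburg
representation theorem. -/
def Represents {R : Type*} [MeasurableSpace R] (μ : Measure R)
    (ρ' : (ℝ → ℝ≥0∞) → ℝ≥0∞) (ρ : (R → ℝ≥0∞) → ℝ≥0∞) : Prop :=
  ∀ f : R → ℝ≥0∞, AEMeasurable f μ → ρ f = ρ' (rearrangement μ f)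

/-- The local component of `A` is stronger than that of `B`. -/
def LocalStronger (A B : (ℝ → ℝ≥0∞) → ℝ≥0∞) : Prop :=
  ∀ f : ℝ → ℝ≥0∞, AEMeasurable f halfLine →
    A ((Icc 0 1).indicator (rearrangement halfLine f)) < ∞ →
    B ((Icc 0 1).indicator (rearrangement halfLine f)) < ∞

/-- The global component of `A` is stronger than that of `B`. -/
def GlobalStronger (A B : (ℝ → ℝ≥0∞) → ℝ≥0∞) : Prop :=
  ∀ f : ℝ → ℝ≥0∞, AEMeasurable f halfLine → rearrangement halfLine f 1 < ∞ →
    A ((Ioi 1).indicator (rearrangement halfLine f)) < ∞ →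
    B ((Ioi 1).indicator (rearrangement halfLine f)) < ∞

section Spaces

variable {R : Type*} [MeasurableSpace R] {𝕜 : Type*} [RCLike 𝕜]

/-- The functional of the intersection `A ∩ B`: `max {‖f‖_A, ‖f‖_B}`. -/
def interNorm (A B : (R → ℝ≥0∞) → ℝ≥0∞) (f : R → 𝕜) : ℝ≥0∞ :=
  max (A fun x => ‖f x‖ₑ) (B fun x => ‖f x‖ₑ)

/-- The functional of the sum `A + B`: the infimum of `‖g‖_A + ‖h‖_B` over all decompositions
`f = g + h` a.e. into measurable functions. It is finite iff there is a decomposition with `g ∈ A`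
and `h ∈ B`. -/
def sumNorm (μ : Measure R) (A B : (R → ℝ≥0∞) → ℝ≥0∞) (f : R → 𝕜) : ℝ≥0∞ :=
  sInf {r : ℝ≥0∞ | ∃ g h : R → 𝕜, AEStronglyMeasurable g μ ∧ AEStronglyMeasurable h μ ∧
    f =ᵐ[μ] g + h ∧ r = (A fun x => ‖g x‖ₑ) + (B fun x => ‖h x‖ₑ)}

/-- The functional of the Wiener–Luxemburg amalgam space `WL(A, B)` over `(R, μ)`, where `A`, `B` are
given on the half-line: `‖f^* χ_{[0,1]}‖_A + ‖f^* χ_{(1,∞)}‖_B`. -/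
def wlNorm (μ : Measure R) (A B : (ℝ → ℝ≥0∞) → ℝ≥0∞) (f : R → 𝕜) : ℝ≥0∞ :=
  A ((Icc 0 1).indicator (rearrangement μ fun x => ‖f x‖ₑ)) +
    B ((Ioi 1).indicator (rearrangement μ fun x => ‖f x‖ₑ))

/-- The function space given by an extended-valued functional `N`: the measurable functions at which
`N` is finite. -/
def space (μ : Measure R) (N : (R → 𝕜) → ℝ≥0∞) : Set (R → 𝕜) :=
  {f | AEStronglyMeasurable f μ ∧ N f < ∞}

/-- `X ↪ Y`: set inclusion, with the inclusion map bounded (for the homogeneous functionals here,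
this is continuity of the inclusion). -/
def Embeds (μ : Measure R) (N₁ N₂ : (R → 𝕜) → ℝ≥0∞) : Prop :=
  space μ N₁ ⊆ space μ N₂ ∧ ∃ C : ℝ≥0, ∀ f ∈ space μ N₁, N₂ f ≤ C * N₁ f

/-- `X = Y` as sets, with equivalent quasinorms. -/
def EqEquivNorms (μ : Measure R) (N₁ N₂ : (R → 𝕜) → ℝ≥0∞) : Prop :=
  space μ N₁ = space μ N₂ ∧
    ∃ C : ℝ≥0, ∀ f ∈ space μ N₁, N₁ f ≤ C * N₂ f ∧ N₂ f ≤ C * N₁ f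

end Spaces

end

end WienerLuxemburg

namespace WienerLuxemburg

/-! ### The non-increasing rearrangement -/

section Rearrangement

variable {R : Type*} [MeasurableSpace R] {μ : Measure R}

/-! Everything rests on truncating `f` at the level `c = f^*(1)`. The set `E = {|f| > c}` has
measure at most 1, so a function restricted to `E` has rearrangement supported in `[0,1]`; off `E`,
`|f|` is at most `c`, and any of the norms controls `c` (`exists_apply_le_mul`). The splitting of
`f` over `E` and its complement gives `WL(A,B) ↪ A+B` (`sumNorm_le_wlNorm`); `A∩B ↪ WL(A,B)` is the
lattice property.

The comparison hypotheses are only qualitative. A gliding hump (`exists_bound_of_forall_lt_top`)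
turns them into inequalities, which bound the two cross terms when `f^*` is cut at 1; this gives
`WL(A,B) ↪ A∩B`.

For `A+B ↪ WL(B,A)` (`exists_wl_le_of_le_add`), let `|f| ≤ g + h`. On `E` the local comparison moves
`g` into `B`; below the level `c` the global comparison moves `min(h,c)` into `A`. These sums are
estimated on `R` itself, so no dilation of rearrangements is needed beyond the single value `f^*(1)
≤ g^*(1/2) + h^*(1/2)`. The reverse embedding is `sumNorm_le_wlNorm` with `A` and `B` exchanged. The
half-line is the case where each norm represents itself. -/

theorem lt_rearrangement_iff (f : R → ℝ≥0∞) (t : ℝ) (s : ℝ≥0∞) :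
    s < rearrangement μ f t ↔ ENNReal.ofReal t < μ {x | s < f x} := by
  constructor
  · intro h
    by_contra hc
    have hle : rearrangement μ f t ≤ s := sInf_le (not_lt.1 hc)
    exact absurd hle (not_le.2 h)
  · intro h
    -- Right-continuity of the distribution function: `{f > s}` is the increasing union of `{f > u
    -- n}` with `u n` decreasing to `s`, so some `u n > s` still has a level set that is too large.
    have hs : s < ∞ := by
      rw [lt_top_iff_ne_top]
      rintro rfl
      simp at h
    obtain ⟨u, hu, hus, hlim⟩ := exists_seq_strictAnti_tendsto' hs
    have hU : {x | s < f x} = ⋃ n, {x | u n < f x} := by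
      ext x
      simp only [mem_ofPred_eq, mem_iUnion]
      constructor
      · intro hx
        exact ((hlim.eventually_lt_const hx)).exists
      · rintro ⟨n, hn⟩
        exact (hus n).1.trans hn
    have hmono : Monotone fun n => {x | u n < f x} := fun m n hmn x hx =>
      (hu.antitone hmn).trans_lt hx
    rw [hU, hmono.measure_iUnion] at h
    obtain ⟨n, hn⟩ := lt_iSup_iff.1 h
    refine (hus n).1.trans_le (le_sInf fun r hr => ?_)
    by_contra hc
    have : μ {x | u n < f x} ≤ μ {x | r < f x} :=
      measure_mono fun x hx => (not_le.1 hc).trans hx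
    exact absurd (this.trans hr) (not_le.2 hn)

theorem rearrangement_antitone (μ : Measure R) (f : R → ℝ≥0∞) : Antitone (rearrangement μ f) :=
  fun _ _ hst => sInf_le_sInf fun _ hr => le_trans hr (ENNReal.ofReal_le_ofReal hst)

theorem rearrangement_le_of_forall {Q : Type*} [MeasurableSpace Q] {ν : Measure Q}
    {f : R → ℝ≥0∞} {g : Q → ℝ≥0∞} {t : ℝ} {b : ℝ≥0∞}
    (h : ∀ s, b ≤ s → μ {x | s < f x} ≤ ν {x | s < g x}) :
    rearrangement μ f t ≤ max (rearrangement ν g t) b := by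
  refine le_of_forall_lt fun s hs => ?_
  rcases lt_or_ge s b with hsb | hsb
  · exact hsb.trans_le (le_max_right _ _)
  · refine lt_of_lt_of_le ?_ (le_max_left _ _)
    rw [lt_rearrangement_iff] at hs ⊢
    exact hs.trans_le (h s hsb)

theorem rearrangement_mono {f g : R → ℝ≥0∞} (h : f ≤ᵐ[μ] g) :
    rearrangement μ f ≤ rearrangement μ g := by
  intro t
  refine le_of_forall_lt fun s hs => ?_
  rw [lt_rearrangement_iff] at hs ⊢
  refine hs.trans_le (measure_mono_ae ?_)
  filter_upwards [h] with x hx hsx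
  exact lt_of_lt_of_le hsx hx

theorem rearrangement_eq_zero {f : R → ℝ≥0∞} {t : ℝ}
    (h : μ {x | 0 < f x} ≤ ENNReal.ofReal t) : rearrangement μ f t = 0 := by
  by_contra hc
  exact absurd ((lt_rearrangement_iff f t 0).1 (pos_iff_ne_zero.2 hc)) (not_lt.2 h)

theorem rearrangement_le_const {f : R → ℝ≥0∞} {c : ℝ≥0∞} (h : ∀ x, f x ≤ c) (t : ℝ) :
    rearrangement μ f t ≤ c := by
  by_contra hc
  have h1 := (lt_rearrangement_iff f t c).1 (not_le.1 hc)
  have h2 : {x | c < f x} = ∅ := by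
    ext x; simpa using h x
  simp [h2] at h1

theorem measure_rearrangement_lt_le (f : R → ℝ≥0∞) (t : ℝ) :
    μ {x | rearrangement μ f t < f x} ≤ ENNReal.ofReal t :=
  not_lt.1 fun h => lt_irrefl _ ((lt_rearrangement_iff f t _).2 h)

/-- With `lt_rearrangement_iff`, this makes `f` and `f^*` equimeasurable. -/
theorem halfLine_setOf_ofReal_lt (m : ℝ≥0∞) : halfLine {x | ENNReal.ofReal x < m} = m := by
  have hm : MeasurableSet {x : ℝ | ENNReal.ofReal x < m} :=
    measurableSet_lt ENNReal.measurable_ofReal measurable_const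
  rw [halfLine, Measure.restrict_apply hm]
  rcases eq_or_ne m ∞ with rfl | h
  · simp
  · have : {x : ℝ | ENNReal.ofReal x < m} ∩ Ici 0 = Ico 0 m.toReal := by
      ext x
      simp only [mem_inter_iff, mem_ofPred_eq, mem_Ici, mem_Ico]
      constructor
      · rintro ⟨h1, h2⟩
        exact ⟨h2, (ENNReal.ofReal_lt_iff_lt_toReal h2 h).1 h1⟩
      · rintro ⟨h1, h2⟩
        exact ⟨(ENNReal.ofReal_lt_iff_lt_toReal h1 h).2 h2, h1⟩
    rw [this, Real.volume_Ico, sub_zero, ENNReal.ofReal_toReal h]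

theorem rearrangement_rearrangement (μ : Measure R) (f : R → ℝ≥0∞) :
    rearrangement halfLine (rearrangement μ f) = rearrangement μ f := by
  have h : ∀ s, halfLine {x | s < rearrangement μ f x} = μ {x | s < f x} := fun s => by
    simp_rw [lt_rearrangement_iff]
    exact halfLine_setOf_ofReal_lt _
  funext t
  change sInf {s | halfLine {x | s < rearrangement μ f x} ≤ _} = sInf {s | μ {x | s < f x} ≤ _}
  simp_rw [h]

theorem ae_halfLine_nonneg : ∀ᵐ x ∂halfLine, 0 ≤ x :=
  ae_restrict_mem measurableSet_Ici

theorem rearrangement_le_of_antitone {G : ℝ → ℝ≥0∞} (hG : Antitone G) (t : ℝ) :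
    rearrangement halfLine G t ≤ G t := by
  refine sInf_le ?_
  have hsub : {x | G t < G x} ⊆ Iio t := fun x hx => by
    by_contra hc
    exact absurd (hG (not_lt.1 hc)) (not_le.2 hx)
  calc halfLine {x | G t < G x} ≤ halfLine (Iio t) := measure_mono hsub
    _ = volume (Ico 0 t) := by
        rw [halfLine, Measure.restrict_apply measurableSet_Iio, inter_comm]; rfl
    _ = ENNReal.ofReal t := by simp

/-- A monotone function has only countably many discontinuities, and the two sides agree at
continuity points. The comparison hypotheses speak of rearrangements, while the gliding hump
produces merely non-increasing functions; this bridges the two. -/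
theorem rearrangement_ae_eq_of_antitone {G : ℝ → ℝ≥0∞} (hG : Antitone G) :
    rearrangement halfLine G =ᵐ[halfLine] G := by
  have hc : ∀ᵐ x ∂halfLine, ContinuousAt G x := by
    have : ∀ᵐ x ∂(volume : Measure ℝ), ContinuousAt G x :=
      hG.countable_not_continuousAt.measure_zero _
    exact ae_restrict_of_ae this
  filter_upwards [hc, ae_halfLine_nonneg] with t hct ht
  refine le_antisymm (rearrangement_le_of_antitone hG t) (le_of_forall_lt fun s hs => ?_)
  rw [lt_rearrangement_iff]
  obtain ⟨ε, hε, hball⟩ := Metric.eventually_nhds_iff.1 (hct.eventually_const_lt hs)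
  have hsub : {x | ENNReal.ofReal x < ENNReal.ofReal (t + ε / 2)} ⊆ {x | s < G x} := by
    intro x hx
    have hx' : x < t + ε / 2 := (ENNReal.ofReal_lt_ofReal_iff (by positivity)).1 hx
    have h1 : s < G (t + ε / 2) := hball (by
      rw [Real.dist_eq, add_sub_cancel_left, abs_of_pos (by positivity)]; linarith)
    exact h1.trans_le (hG hx'.le)
  calc ENNReal.ofReal t < ENNReal.ofReal (t + ε / 2) :=
        (ENNReal.ofReal_lt_ofReal_iff (by positivity)).2 (by linarith)
    _ = _ := (halfLine_setOf_ofReal_lt _).symm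
    _ ≤ _ := measure_mono hsub

/-- A value of the rearrangement of a sum is controlled by values of the rearrangements of the
summands at half the argument. -/
theorem rearrangement_le_add_half {f g h : R → ℝ≥0∞} (hf : f ≤ᵐ[μ] fun x => g x + h x) {t : ℝ}
    (ht : 0 ≤ t) :
    rearrangement μ f t ≤ rearrangement μ g (t / 2) + rearrangement μ h (t / 2) := by
  refine sInf_le ?_
  set a := rearrangement μ g (t / 2)
  set b := rearrangement μ h (t / 2)
  calc μ {x | a + b < f x} ≤ μ ({x | a < g x} ∪ {x | b < h x}) := by
        refine measure_mono_ae ?_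
        filter_upwards [hf] with x hx hab
        by_contra hc
        have hc' : ¬ (a < g x ∨ b < h x) := hc
        push Not at hc'
        exact absurd (hx.trans (add_le_add hc'.1 hc'.2)) (not_le.2 hab)
    _ ≤ ENNReal.ofReal (t / 2) + ENNReal.ofReal (t / 2) :=
        (measure_union_le _ _).trans
          (add_le_add (measure_rearrangement_lt_le _ _) (measure_rearrangement_lt_le _ _))
    _ = ENNReal.ofReal t := by
        rw [← ENNReal.ofReal_add (by positivity) (by positivity), add_halves]

end Rearrangement

/-! ### Countable sums in a quasinorm -/

namespace IsQuasiBanachFunctionNorm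

variable {R : Type*} [MeasurableSpace R] {μ : Measure R} {ρ : (R → ℝ≥0∞) → ℝ≥0∞}

theorem congr_ae (hρ : IsQuasiBanachFunctionNorm μ ρ) {f g : R → ℝ≥0∞} (hf : AEMeasurable f μ)
    (h : f =ᵐ[μ] g) : ρ f = ρ g :=
  le_antisymm (hρ.mono _ _ hf (hf.congr h) h.le) (hρ.mono _ _ (hf.congr h) hf h.symm.le)

theorem sum_range_le (hρ : IsQuasiBanachFunctionNorm μ ρ) {D : ℝ≥0}
    (hD : ∀ f g : R → ℝ≥0∞, AEMeasurable f μ → AEMeasurable g μ →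
      ρ (fun x => f x + g x) ≤ D * (ρ f + ρ g)) (n : ℕ) (u : ℕ → R → ℝ≥0∞)
    (hu : ∀ k, AEMeasurable (u k) μ) :
    ρ (fun x => ∑ k ∈ Finset.range n, u k x) ≤
      ∑ k ∈ Finset.range n, (D : ℝ≥0∞) ^ (k + 1) * ρ (u k) := by
  induction n generalizing u with
  | zero =>
    simp only [Finset.range_zero, Finset.sum_empty, nonpos_iff_eq_zero]
    exact (hρ.eq_zero_iff _ aemeasurable_const).2 (ae_eq_refl _)
  | succ n ih =>
    -- Peeling off the first term, not the last, lets the `k`-th term pay only `k + 1` factors of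
    -- `D`, independently of `n`; this is what survives the passage to infinite sums.
    simp_rw [Finset.sum_range_succ']
    refine (hD _ _ (Finset.aemeasurable_fun_sum _ fun k _ => hu (k + 1)) (hu 0)).trans ?_
    rw [mul_add]
    refine add_le_add ?_ (by simp)
    refine (mul_le_mul_right (ih (fun k => u (k + 1)) fun k => hu (k + 1)) _).trans (le_of_eq ?_)
    rw [Finset.mul_sum]
    exact Finset.sum_congr rfl fun k _ => by ring

theorem tsum_le (hρ : IsQuasiBanachFunctionNorm μ ρ) {D : ℝ≥0}
    (hD : ∀ f g : R → ℝ≥0∞, AEMeasurable f μ → AEMeasurable g μ →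
      ρ (fun x => f x + g x) ≤ D * (ρ f + ρ g)) (u : ℕ → R → ℝ≥0∞)
    (hu : ∀ k, AEMeasurable (u k) μ) :
    ρ (fun x => ∑' k, u k x) ≤ ∑' k, (D : ℝ≥0∞) ^ (k + 1) * ρ (u k) := by
  refine le_of_tendsto' (hρ.fatou (fun n x => ∑ k ∈ Finset.range n, u k x) _
    (fun n => Finset.aemeasurable_fun_sum _ fun k _ => hu k) (AEMeasurable.tsum hu)
    (ae_of_all _ fun x => ?_) (ae_of_all _ fun x => ENNReal.tendsto_nat_tsum _)) fun n => ?_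
  · exact fun m n hmn => Finset.sum_le_sum_of_subset (Finset.range_mono hmn)
  · exact (hρ.sum_range_le hD n u hu).trans (ENNReal.sum_le_tsum _)

end IsQuasiBanachFunctionNorm

/-! ### Comparison of norms on non-increasing functions -/

section HalfLine

variable {A B : (ℝ → ℝ≥0∞) → ℝ≥0∞}

/-- `G ≥ G t` on `[0,t]`, so the constant is the reciprocal of the norm of the characteristic
function of `[0,t]`. As `G t` may be infinite and homogeneity concerns finite scalars, the proof
works with finite `r < G t`. -/
theorem exists_apply_le_mul (hA : IsQuasiBanachFunctionNorm halfLine A) {t : ℝ} (ht : 0 < t) :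
    ∃ K : ℝ≥0, ∀ G : ℝ → ℝ≥0∞, Antitone G → G t ≤ K * A ((Icc 0 t).indicator G) := by
  have hvol : halfLine (Icc 0 t) = ENNReal.ofReal t := by
    rw [halfLine, Measure.restrict_apply measurableSet_Icc,
      inter_eq_self_of_subset_left Icc_subset_Ici_self]
    simp
  have hmeas : Measurable ((Icc 0 t).indicator fun _ : ℝ => (1 : ℝ≥0∞)) :=
    measurable_const.indicator measurableSet_Icc
  set a := A ((Icc 0 t).indicator fun _ => 1)
  have ha : a ≠ ∞ := (hA.indicator_lt_top _ measurableSet_Icc (by simp [hvol])).ne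
  have ha0 : a ≠ 0 := fun h => by
    have h1 := (hA.eq_zero_iff _ hmeas.aemeasurable).1 h
    have h2 : halfLine (Icc 0 t) ≤ 0 := by
      refine (measure_mono fun x hx => ?_).trans (ae_iff.1 h1).le
      simpa using hx
    rw [hvol] at h2
    simp at h2
    linarith
  refine ⟨a.toNNReal⁻¹, fun G hG => ENNReal.le_of_forall_nnreal_lt fun r hr => ?_⟩
  rw [ENNReal.coe_inv (by simp [ENNReal.toNNReal_eq_zero_iff, ha, ha0]), ENNReal.coe_toNNReal ha,
    mul_comm, ← div_eq_mul_inv, ENNReal.le_div_iff_mul_le (Or.inl ha0) (Or.inl ha),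
    ← hA.smul r _ hmeas.aemeasurable]
  refine hA.mono _ _ (hmeas.const_mul _).aemeasurable
    (hG.measurable.indicator measurableSet_Icc).aemeasurable (ae_of_all _ fun x => ?_)
  by_cases hx : x ∈ Icc 0 t
  · simpa [hx] using hr.le.trans (hG hx.2)
  · simp [hx]

theorem exists_const_le_mul (hA : IsQuasiBanachFunctionNorm halfLine A) :
    ∃ K : ℝ≥0, ∀ c : ℝ≥0∞, A ((Icc 0 1).indicator fun _ => c) ≤ K * c := by
  have hmeas : Measurable ((Icc 0 1).indicator fun _ : ℝ => (1 : ℝ≥0∞)) :=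
    measurable_const.indicator measurableSet_Icc
  set a := A ((Icc 0 1).indicator fun _ => 1)
  have ha : a ≠ ∞ := by
    refine (hA.indicator_lt_top _ measurableSet_Icc ?_).ne
    exact (Measure.restrict_apply_le _ _).trans_lt (by simp)
  -- The added 1 keeps the constant nonzero, so that the right side is `∞` when `c = ∞`.
  refine ⟨a.toNNReal + 1, fun c => ?_⟩
  induction c with
  | top => simp [ENNReal.mul_top]
  | coe c =>
    have h : ((Icc (0 : ℝ) 1).indicator fun _ => (c : ℝ≥0∞)) =
        fun x => (c : ℝ≥0∞) * (Icc (0 : ℝ) 1).indicator (fun _ => 1) x := by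
      funext x
      by_cases hx : x ∈ Icc (0 : ℝ) 1 <;> simp [hx]
    rw [h, hA.smul c _ hmeas.aemeasurable, mul_comm]
    gcongr
    push_cast
    rw [ENNReal.coe_toNNReal ha]
    exact le_self_add

/-- A qualitative domination between two quasinorms on the cone of non-increasing functions is
automatically quantitative (a gliding hump argument). -/
theorem exists_bound_of_forall_lt_top (hA : IsQuasiBanachFunctionNorm halfLine A)
    (hB : IsQuasiBanachFunctionNorm halfLine B) {S : Set ℝ} (hS : MeasurableSet S) (t : ℝ)
    (H : ∀ G : ℝ → ℝ≥0∞, Antitone G → G t < ∞ → A (S.indicator G) < ∞ → B (S.indicator G) < ∞) :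
    ∃ C : ℝ≥0, ∀ G : ℝ → ℝ≥0∞, Antitone G →
      B (S.indicator G) ≤ C * (A (S.indicator G) + G t) := by
  obtain ⟨D, hD1, hD⟩ := hA.add_le
  by_contra! hcon
  have hD0 : 0 < D := by positivity
  -- The factor `(2 * D) ^ (n + 1)` will pay for the weights `D ^ (n + 1)` of `tsum_le` and leave a
  -- geometric series; the factor `n + 1` forces the blow-up of `B`.
  choose G hG hGB using fun n : ℕ => hcon ((n + 1) * (2 * D) ^ (n + 1))
  have hm : ∀ {F : ℝ → ℝ≥0∞}, Antitone F → AEMeasurable (S.indicator F) halfLine :=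
    fun hF => (hF.measurable.indicator hS).aemeasurable
  set N : ℕ → ℝ≥0∞ := fun n => A (S.indicator (G n)) + G n t with hN
  have hNtop : ∀ n, N n ≠ ∞ := fun n hn => by
    have h := hGB n
    change _ * N n < _ at h
    rw [hn, ENNReal.mul_top (by positivity)] at h
    exact not_top_lt h
  have hN0 : ∀ n, N n ≠ 0 := fun n hn => by
    have h := hGB n
    have h1 : A (S.indicator (G n)) = 0 := (add_eq_zero.1 hn).1
    have h2 := (hB.eq_zero_iff _ (hm (hG n))).2 ((hA.eq_zero_iff _ (hm (hG n))).1 h1)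
    rw [h2] at h
    exact not_lt_zero h
  -- Normalisation: `c n * G n` has `N`-size exactly `(2 * D) ^ -(n + 1)`.
  set c : ℕ → ℝ≥0 := fun n => (N n).toNNReal⁻¹ * ((2 * D) ^ (n + 1))⁻¹ with hc
  have hcN : ∀ n, (c n : ℝ≥0∞) * N n = (((2 * D) ^ (n + 1))⁻¹ : ℝ≥0) := fun n => by
    have h0 : (N n).toNNReal ≠ 0 := by simp [ENNReal.toNNReal_eq_zero_iff, hN0 n, hNtop n]
    rw [← ENNReal.coe_toNNReal (hNtop n), ← ENNReal.coe_mul]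
    congr 1
    simp only [hc]
    rw [mul_right_comm, inv_mul_cancel₀ h0, one_mul]
  have hind : ∀ n, S.indicator (fun x => c n * G n x) = fun x => c n * S.indicator (G n) x :=
    fun n => by
      funext x
      by_cases hx : x ∈ S <;> simp [hx]
  have hanti : ∀ n, Antitone fun x => c n * G n x := fun n x y hxy =>
    mul_le_mul_right (hG n hxy) _
  set F : ℝ → ℝ≥0∞ := fun x => ∑' n, c n * G n x
  have hF : Antitone F := fun x y hxy => ENNReal.tsum_le_tsum fun n => hanti n hxy
  have hgeom : ∑' n : ℕ, (2⁻¹ : ℝ≥0∞) ^ (n + 1) < ∞ := by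
    rw [ENNReal.tsum_geometric_add_one, ENNReal.one_sub_inv_two, inv_inv]
    exact ENNReal.mul_lt_top (by simp) (by simp)
  have hcoe : ∀ n : ℕ, (D : ℝ≥0∞) ^ (n + 1) * (((2 * D) ^ (n + 1))⁻¹ : ℝ≥0) = 2⁻¹ ^ (n + 1) := by
    intro n
    have : (2⁻¹ : ℝ≥0∞) ^ (n + 1) = ((2⁻¹ ^ (n + 1) : ℝ≥0) : ℝ≥0∞) := by
      rw [ENNReal.coe_pow, ENNReal.coe_inv two_ne_zero, ENNReal.coe_ofNat]
    rw [this, ← ENNReal.coe_pow, ← ENNReal.coe_mul]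
    congr 1
    rw [mul_pow, mul_inv, inv_pow]
    field_simp
  -- This is why `G t` is part of `N`: the sum `F` must meet the finiteness condition in `H`.
  have hFt : F t < ∞ := by
    refine lt_of_le_of_lt (ENNReal.tsum_le_tsum fun n => ?_) hgeom
    calc (c n : ℝ≥0∞) * G n t ≤ c n * N n := by gcongr; exact le_add_self
      _ ≤ (D : ℝ≥0∞) ^ (n + 1) * (c n * N n) :=
          le_mul_of_one_le_left' (one_le_pow₀ (by exact_mod_cast hD1))
      _ = _ := by rw [hcN, hcoe]
  have hAF : A (S.indicator F) < ∞ := by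
    have h1 : S.indicator F = fun x => ∑' n, S.indicator (fun x => c n * G n x) x := by
      funext x
      by_cases hx : x ∈ S <;> simp [hx, F]
    rw [h1]
    refine (hA.tsum_le hD _ fun n => hm (hanti n)).trans_lt
      (lt_of_le_of_lt (ENNReal.tsum_le_tsum fun n => ?_) hgeom)
    rw [hind, hA.smul _ _ (hm (hG n))]
    calc (D : ℝ≥0∞) ^ (n + 1) * (c n * A (S.indicator (G n)))
        ≤ (D : ℝ≥0∞) ^ (n + 1) * (c n * N n) := by gcongr; exact le_self_add
      _ = _ := by rw [hcN, hcoe]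
  -- `F` dominates each `c n * G n`, whose `B`-size is at least `n + 1`.
  refine (H F hF hFt hAF).ne (ENNReal.eq_top_of_forall_nnreal_le fun r => ?_)
  obtain ⟨n, hn⟩ := exists_nat_ge r
  calc (r : ℝ≥0∞) ≤ ((n + 1 : ℝ≥0) : ℝ≥0∞) := by
        exact_mod_cast hn.trans (le_add_of_nonneg_right zero_le_one)
    _ = ((n + 1) * (2 * D) ^ (n + 1) : ℝ≥0) * (c n * N n) := by
        rw [hcN, ← ENNReal.coe_mul, mul_assoc, mul_inv_cancel₀ (by positivity), mul_one]
    _ = c n * (((n + 1) * (2 * D) ^ (n + 1) : ℝ≥0) * N n) := by ring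
    _ ≤ c n * B (S.indicator (G n)) := mul_le_mul_right (hGB n).le _
    _ = B (S.indicator fun x => c n * G n x) := by rw [hind, hB.smul _ _ (hm (hG n))]
    _ ≤ B (S.indicator F) := by
        refine hB.mono _ _ (hm (hanti n)) (hm hF) (ae_of_all _ fun x => ?_)
        exact indicator_le_indicator (ENNReal.le_tsum n)

theorem indicator_rearrangement_ae_eq (S : Set ℝ) {G : ℝ → ℝ≥0∞} (hG : Antitone G) :
    S.indicator G =ᵐ[halfLine] S.indicator (rearrangement halfLine G) := by
  filter_upwards [rearrangement_ae_eq_of_antitone hG] with x hx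
  by_cases h : x ∈ S <;> simp [h, hx]

theorem LocalStronger.exists_bound (hA : IsQuasiBanachFunctionNorm halfLine A)
    (hB : IsQuasiBanachFunctionNorm halfLine B) (h : LocalStronger A B) :
    ∃ C : ℝ≥0, ∀ G : ℝ → ℝ≥0∞, Antitone G →
      B ((Icc 0 1).indicator G) ≤ C * A ((Icc 0 1).indicator G) := by
  obtain ⟨C, hC⟩ := exists_bound_of_forall_lt_top hA hB (S := Icc 0 1) measurableSet_Icc 1
    fun G hG _ hAG => by
      have hm := (hG.measurable.indicator (measurableSet_Icc (a := 0) (b := 1))).aemeasurable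
        (μ := halfLine)
      have hae := indicator_rearrangement_ae_eq (Icc 0 1) hG
      rw [hB.congr_ae hm hae]
      rw [hA.congr_ae hm hae] at hAG
      exact h G hG.measurable.aemeasurable hAG
  -- Here the extra term `G 1` is absorbed, being controlled by the part of `G` on `[0,1]`.
  obtain ⟨K, hK⟩ := exists_apply_le_mul hA one_pos
  refine ⟨C * (1 + K), fun G hG => (hC G hG).trans ?_⟩
  calc (C : ℝ≥0∞) * (A ((Icc 0 1).indicator G) + G 1)
      ≤ C * (A ((Icc 0 1).indicator G) + K * A ((Icc 0 1).indicator G)) := by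
        gcongr; exact hK G hG
    _ = _ := by push_cast; ring

/-- The term `G 1` cannot be dropped: for `A = L^1`, `B = L^∞` and `G = n` on `[0, 1 + 1/n)`, zero
beyond, the two parts on `(1,∞)` have sizes 1 and `n`. -/
theorem GlobalStronger.exists_bound (hA : IsQuasiBanachFunctionNorm halfLine A)
    (hB : IsQuasiBanachFunctionNorm halfLine B) (h : GlobalStronger A B) :
    ∃ C : ℝ≥0, ∀ G : ℝ → ℝ≥0∞, Antitone G →
      B ((Ioi 1).indicator G) ≤ C * (A ((Ioi 1).indicator G) + G 1) :=
  exists_bound_of_forall_lt_top hA hB (S := Ioi 1) measurableSet_Ioi 1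
    fun G hG hG1 hAG => by
      have hm := (hG.measurable.indicator (measurableSet_Ioi (a := 1))).aemeasurable
        (μ := halfLine)
      have hae := indicator_rearrangement_ae_eq (Ioi 1) hG
      rw [hB.congr_ae hm hae]
      rw [hA.congr_ae hm hae] at hAG
      exact h G hG.measurable.aemeasurable
        ((rearrangement_le_of_antitone hG 1).trans_lt hG1) hAG

end HalfLine

end WienerLuxemburg
-- Truncation at the level `f^*(1)` and the embeddings
namespace WienerLuxemburg

variable {R : Type*} [MeasurableSpace R] {μ : Measure R} {A B : (ℝ → ℝ≥0∞) → ℝ≥0∞}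
  {A' B' : (R → ℝ≥0∞) → ℝ≥0∞}

theorem aemeasurable_indicator_rearrangement {S : Set ℝ} (hS : MeasurableSet S) (μ : Measure R)
    (f : R → ℝ≥0∞) : AEMeasurable (S.indicator (rearrangement μ f)) halfLine :=
  ((rearrangement_antitone μ f).measurable.indicator hS).aemeasurable

theorem aemeasurable_indicator_const {S : Set ℝ} (hS : MeasurableSet S) (c : ℝ≥0∞) :
    AEMeasurable (S.indicator fun _ => c) halfLine :=
  (measurable_const.indicator hS).aemeasurable

theorem aemeasurable_rearrangement (μ : Measure R) (f : R → ℝ≥0∞) :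
    AEMeasurable (rearrangement μ f) halfLine :=
  (rearrangement_antitone μ f).measurable.aemeasurable

theorem apply_indicator_rearrangement_le (hA : IsQuasiBanachFunctionNorm halfLine A) {S : Set ℝ}
    (hS : MeasurableSet S) (f : R → ℝ≥0∞) :
    A (S.indicator (rearrangement μ f)) ≤ A (rearrangement μ f) :=
  hA.mono _ _ (aemeasurable_indicator_rearrangement hS μ f) (aemeasurable_rearrangement μ f)
    (ae_of_all _ fun x => indicator_le_self S _ x)

/-- The restriction of `g` to the set where `f` exceeds `f^*(1)` has rearrangement supported in `[0, 1]`. -/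
theorem rearrangement_indicator_gt_le (f g : R → ℝ≥0∞) :
    rearrangement μ ({x | rearrangement μ f 1 < f x}.indicator g) ≤ᵐ[halfLine]
      (Icc 0 1).indicator (rearrangement μ g) := by
  filter_upwards [ae_halfLine_nonneg] with t ht
  rcases le_or_gt t 1 with h1 | h1
  · rw [indicator_of_mem (show t ∈ Icc (0 : ℝ) 1 from ⟨ht, h1⟩)]
    exact rearrangement_mono (ae_of_all _ fun x => indicator_le_self _ _ x) t
  · rw [rearrangement_eq_zero]
    · exact bot_le
    · refine (measure_mono fun x hx => ?_).trans ((measure_rearrangement_lt_le f 1).trans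
        (ENNReal.ofReal_le_ofReal h1.le))
      by_contra hc
      have : {x | rearrangement μ f 1 < f x}.indicator g x = 0 := indicator_of_notMem hc _
      exact absurd hx (by simp [this])

/-- A function bounded by `c` has rearrangement at most `c` on `[0, 1]`. -/
theorem rearrangement_le_of_le_const {f g : R → ℝ≥0∞} {c : ℝ≥0∞} (hc : ∀ x, g x ≤ c)
    (hf : g ≤ᵐ[μ] f) :
    rearrangement μ g ≤ᵐ[halfLine] fun t => (Icc 0 1).indicator (fun _ => c) t +
      (Ioi 1).indicator (rearrangement μ f) t := by
  filter_upwards [ae_halfLine_nonneg] with t ht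
  rcases le_or_gt t 1 with h1 | h1
  · rw [indicator_of_mem (show t ∈ Icc (0 : ℝ) 1 from ⟨ht, h1⟩)]
    exact (rearrangement_le_const hc t).trans le_self_add
  · rw [indicator_of_mem (show t ∈ Ioi (1 : ℝ) from h1)]
    exact (rearrangement_mono hf t).trans le_add_self

/-- Restricting `f` to `{f > f^*(1)}` changes no level set at levels `s ≥ f^*(1)`. -/
theorem indicator_Icc_rearrangement_le (f : R → ℝ≥0∞) :
    (Icc 0 1).indicator (rearrangement μ f) ≤ fun t =>
      rearrangement μ ({x | rearrangement μ f 1 < f x}.indicator f) t +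
        (Icc 0 1).indicator (fun _ => rearrangement μ f 1) t := by
  intro t
  by_cases ht : t ∈ Icc (0 : ℝ) 1
  · beta_reduce
    rw [indicator_of_mem ht, indicator_of_mem ht]
    refine le_trans (rearrangement_le_of_forall (ν := μ) (b := rearrangement μ f 1)
      (g := {x | rearrangement μ f 1 < f x}.indicator f) fun s hs => ?_)
      (max_le le_self_add le_add_self)
    refine measure_mono fun x hx => ?_
    have hx' : x ∈ {x | rearrangement μ f 1 < f x} := lt_of_le_of_lt hs hx
    change s < _
    rwa [indicator_of_mem hx']
  · rw [indicator_of_notMem ht]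
    exact bot_le

/-- Beyond 1 only levels below `f^*(1)` matter, and capping there leaves those level sets unchanged.
-/
theorem indicator_Ioi_rearrangement_le (f : R → ℝ≥0∞) :
    (Ioi 1).indicator (rearrangement μ f) ≤
      rearrangement μ fun x => min (f x) (rearrangement μ f 1) := by
  intro t
  by_cases ht : t ∈ Ioi (1 : ℝ)
  · rw [indicator_of_mem ht]
    refine le_of_forall_lt fun s hs => ?_
    have hs1 : s < rearrangement μ f 1 :=
      hs.trans_le (rearrangement_antitone μ f (le_of_lt ht))
    rw [lt_rearrangement_iff] at hs ⊢
    exact hs.trans_le (measure_mono fun x hx => lt_min hx hs1)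
  · rw [indicator_of_notMem ht]
    exact bot_le

theorem wlNorm_le_interNorm {𝕜 : Type*} [RCLike 𝕜] (hA : IsQuasiBanachFunctionNorm halfLine A)
    (hB : IsQuasiBanachFunctionNorm halfLine B) (hAA' : Represents μ A A')
    (hBB' : Represents μ B B') {f : R → 𝕜} (hf : AEStronglyMeasurable f μ) :
    wlNorm μ A B f ≤ (2 : ℝ≥0) * interNorm A' B' f := by
  rw [interNorm, hAA' _ hf.enorm, hBB' _ hf.enorm, ENNReal.coe_ofNat, two_mul]
  exact add_le_add
    ((apply_indicator_rearrangement_le hA measurableSet_Icc _).trans (le_max_left _ _))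
    ((apply_indicator_rearrangement_le hB measurableSet_Ioi _).trans (le_max_right _ _))

theorem sumNorm_le_wlNorm (𝕜 : Type*) [RCLike 𝕜] (hA : IsQuasiBanachFunctionNorm halfLine A)
    (hB : IsQuasiBanachFunctionNorm halfLine B) (hAA' : Represents μ A A')
    (hBB' : Represents μ B B') :
    ∃ C : ℝ≥0, ∀ f : R → 𝕜, AEStronglyMeasurable f μ →
      sumNorm μ A' B' f ≤ C * wlNorm μ A B f := by
  obtain ⟨D, -, hD⟩ := hB.add_le
  obtain ⟨K, hK⟩ := exists_apply_le_mul hA one_pos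
  obtain ⟨L, hL⟩ := exists_const_le_mul hB
  -- The 1 pays for the part of `f` on `E`. Off `E`, the rearrangement is at most `c` on `[0,1]`,
  -- costing `L * K` because `c ≤ K * a`, and at most `f^*` beyond; `D` joins these two pieces.
  refine ⟨1 + D * (L * K + 1), fun f hf => ?_⟩
  set F : R → ℝ≥0∞ := fun x => ‖f x‖ₑ with hF
  set c := rearrangement μ F 1 with hc
  set E : Set R := {x | c < F x} with hE
  have hFm : AEMeasurable F μ := hf.enorm
  have hEm : NullMeasurableSet E μ := nullMeasurableSet_lt aemeasurable_const hFm
  have hg := hf.indicator₀ hEm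
  have hh := hf.indicator₀ hEm.compl
  set a := A ((Icc 0 1).indicator (rearrangement μ F)) with ha
  set b := B ((Ioi 1).indicator (rearrangement μ F)) with hb
  have hgA : A' (fun x => ‖E.indicator f x‖ₑ) ≤ a := by
    rw [hAA' _ hg.enorm]
    simp_rw [enorm_indicator_eq_indicator_enorm]
    exact hA.mono _ _ (aemeasurable_rearrangement _ _)
      (aemeasurable_indicator_rearrangement measurableSet_Icc _ _)
      (rearrangement_indicator_gt_le F F)
  have hhB : B' (fun x => ‖Eᶜ.indicator f x‖ₑ) ≤ D * (L * (K * a) + b) := by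
    rw [hBB' _ hh.enorm]
    simp_rw [enorm_indicator_eq_indicator_enorm]
    have h1 : ∀ x, Eᶜ.indicator F x ≤ c := fun x => by
      by_cases hx : x ∈ E
      · simp [hx]
      · simpa [hx] using not_lt.1 hx
    refine (hB.mono _ _ (aemeasurable_rearrangement _ _)
      ((aemeasurable_indicator_const measurableSet_Icc _).add
        (aemeasurable_indicator_rearrangement measurableSet_Ioi _ _))
      (rearrangement_le_of_le_const h1 (ae_of_all _ fun x => indicator_le_self _ _ x))).trans ?_
    refine (hD _ _ (aemeasurable_indicator_const measurableSet_Icc _)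
        (aemeasurable_indicator_rearrangement measurableSet_Ioi _ _)).trans ?_
    gcongr
    refine (hL c).trans ?_
    gcongr
    exact hK _ (rearrangement_antitone μ F)
  calc sumNorm μ A' B' f ≤ A' (fun x => ‖E.indicator f x‖ₑ) + B' (fun x => ‖Eᶜ.indicator f x‖ₑ) :=
        sInf_le ⟨_, _, hg, hh, by rw [indicator_self_add_compl], rfl⟩
    _ ≤ (a + b) + D * (L * (K * (a + b)) + (a + b)) := by
        refine add_le_add (hgA.trans le_self_add) (hhB.trans ?_)
        gcongr
        · exact le_self_add
        · exact le_add_self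
    _ = _ := by
        rw [wlNorm]
        push_cast
        ring

theorem interNorm_le_wlNorm (𝕜 : Type*) [RCLike 𝕜] (hA : IsQuasiBanachFunctionNorm halfLine A)
    (hB : IsQuasiBanachFunctionNorm halfLine B) (hAA' : Represents μ A A')
    (hBB' : Represents μ B B') (hloc : LocalStronger A B) (hglob : GlobalStronger B A) :
    ∃ C : ℝ≥0, ∀ f : R → 𝕜, AEStronglyMeasurable f μ →
      interNorm A' B' f ≤ C * wlNorm μ A B f := by
  obtain ⟨D, -, hD⟩ := hA.add_le
  obtain ⟨D', -, hD'⟩ := hB.add_le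
  obtain ⟨K, hK⟩ := exists_apply_le_mul hA one_pos
  obtain ⟨M, hM⟩ := hloc.exists_bound hA hB
  obtain ⟨M', hM'⟩ := hglob.exists_bound hB hA
  refine ⟨D * (1 + M' * (1 + K)) + D' * (M + 1), fun f hf => ?_⟩
  rw [interNorm, hAA' _ hf.enorm, hBB' _ hf.enorm]
  set G := rearrangement μ fun x => ‖f x‖ₑ with hG
  have hGa : Antitone G := rearrangement_antitone _ _
  have hm1 : AEMeasurable ((Icc 0 1).indicator G) halfLine :=
    aemeasurable_indicator_rearrangement measurableSet_Icc _ _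
  have hm2 : AEMeasurable ((Ioi 1).indicator G) halfLine :=
    aemeasurable_indicator_rearrangement measurableSet_Ioi _ _
  have hsplit : G ≤ᵐ[halfLine] fun t => (Icc 0 1).indicator G t + (Ioi 1).indicator G t := by
    filter_upwards [ae_halfLine_nonneg] with t ht
    rcases le_or_gt t 1 with h1 | h1
    · rw [indicator_of_mem (show t ∈ Icc (0 : ℝ) 1 from ⟨ht, h1⟩)]
      exact le_self_add
    · rw [indicator_of_mem (show t ∈ Ioi (1 : ℝ) from h1)]
      exact le_add_self
  have hGm : AEMeasurable G halfLine := aemeasurable_rearrangement _ _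
  set N := wlNorm μ A B f with hN
  have h1 : A ((Icc 0 1).indicator G) ≤ N := le_self_add
  have h2 : B ((Ioi 1).indicator G) ≤ N := le_add_self
  have hAG : A G ≤ D * (1 + M' * (1 + K)) * N := by
    calc A G ≤ D * (A ((Icc 0 1).indicator G) + A ((Ioi 1).indicator G)) :=
          (hA.mono _ _ hGm (hm1.add hm2) hsplit).trans (hD _ _ hm1 hm2)
      _ ≤ D * (A ((Icc 0 1).indicator G) +
            M' * (B ((Ioi 1).indicator G) + K * A ((Icc 0 1).indicator G))) := by
          gcongr
          -- The value `G 1` left over from the global comparison is absorbed by the local `A`-part.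
          refine (hM' G hGa).trans ?_
          gcongr
          exact hK G hGa
      _ ≤ D * (N + M' * (N + K * N)) := by gcongr
      _ = _ := by ring
  have hBG : B G ≤ D' * (M + 1) * N := by
    calc B G ≤ D' * (B ((Icc 0 1).indicator G) + B ((Ioi 1).indicator G)) :=
          (hB.mono _ _ hGm (hm1.add hm2) hsplit).trans (hD' _ _ hm1 hm2)
      _ ≤ D' * (M * A ((Icc 0 1).indicator G) + B ((Ioi 1).indicator G)) := by
          gcongr
          exact hM G hGa
      _ ≤ D' * (M * N + N) := by gcongr
      _ = _ := by ring
  push_cast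
  rw [add_mul]
  exact max_le (hAG.trans le_self_add) (hBG.trans le_add_self)

/-- The amalgam quasinorm `WL(B, A)` of a function dominated by `g + h` is controlled by
`‖g‖_A + ‖h‖_B`. -/
theorem exists_wl_le_of_le_add (hA : IsQuasiBanachFunctionNorm halfLine A)
    (hB : IsQuasiBanachFunctionNorm halfLine B) (hA' : IsQuasiBanachFunctionNorm μ A')
    (hB' : IsQuasiBanachFunctionNorm μ B') (hAA' : Represents μ A A') (hBB' : Represents μ B B')
    (hloc : LocalStronger A B) (hglob : GlobalStronger B A) :
    ∃ C : ℝ≥0, ∀ f g h : R → ℝ≥0∞, AEMeasurable f μ → AEMeasurable g μ → AEMeasurable h μ →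
      (f ≤ᵐ[μ] fun x => g x + h x) →
      B ((Icc 0 1).indicator (rearrangement μ f)) + A ((Ioi 1).indicator (rearrangement μ f)) ≤
        C * (A' g + B' h) := by
  obtain ⟨DA, -, hDA⟩ := hA.add_le
  obtain ⟨DB, -, hDB⟩ := hB.add_le
  obtain ⟨DA', -, hDA'⟩ := hA'.add_le
  obtain ⟨DB', -, hDB'⟩ := hB'.add_le
  -- The argument is 1/2 because `f^*(1)` is split as `g^*(1/2) + h^*(1/2)`.
  obtain ⟨KA, hKA⟩ := exists_apply_le_mul hA (t := 1 / 2) (by norm_num)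
  obtain ⟨KB, hKB⟩ := exists_apply_le_mul hB (t := 1 / 2) (by norm_num)
  obtain ⟨LA, hLA⟩ := exists_const_le_mul hA
  obtain ⟨LB, hLB⟩ := exists_const_le_mul hB
  obtain ⟨M, hM⟩ := hloc.exists_bound hA hB
  obtain ⟨M', hM'⟩ := hglob.exists_bound hB hA
  refine ⟨DB * (DB' * (M + 1) + LB * (KA + KB)) +
    DA' * (1 + DA * (LA * (KA + KB) + M' * (1 + KB))), fun f g h hf hg hh hfgh => ?_⟩
  set N := A' g + B' h with hN
  set c := rearrangement μ f 1 with hc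
  set E : Set R := {x | c < f x} with hE
  have hEm : NullMeasurableSet E μ := nullMeasurableSet_lt aemeasurable_const hf
  have hgN : A (rearrangement μ g) ≤ N := (hAA' g hg).symm.le.trans le_self_add
  have hhN : B (rearrangement μ h) ≤ N := (hBB' h hh).symm.le.trans le_add_self
  have hghalf : rearrangement μ g (1 / 2) ≤ KA * N :=
    (hKA _ (rearrangement_antitone μ g)).trans (mul_le_mul_right
      ((apply_indicator_rearrangement_le hA measurableSet_Icc g).trans hgN) _)
  have hhhalf : rearrangement μ h (1 / 2) ≤ KB * N :=
    (hKB _ (rearrangement_antitone μ h)).trans (mul_le_mul_right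
      ((apply_indicator_rearrangement_le hB measurableSet_Icc h).trans hhN) _)
  have hcN : c ≤ (KA + KB) * N := by
    rw [add_mul]
    exact (rearrangement_le_add_half hfgh zero_le_one).trans (add_le_add hghalf hhhalf)
  -- `E` is cut out by `f`, not `g`; only its measure being at most 1 matters, and the local
  -- comparison then applies to `g`.
  have hgE : B' (E.indicator g) ≤ M * N := by
    rw [hBB' _ (hg.indicator₀ hEm)]
    calc B (rearrangement μ (E.indicator g)) ≤ B ((Icc 0 1).indicator (rearrangement μ g)) :=
          hB.mono _ _ (aemeasurable_rearrangement _ _)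
            (aemeasurable_indicator_rearrangement measurableSet_Icc _ _)
            (rearrangement_indicator_gt_le f g)
      _ ≤ M * A ((Icc 0 1).indicator (rearrangement μ g)) := hM _ (rearrangement_antitone μ g)
      _ ≤ M * N := by
          gcongr
          exact (apply_indicator_rearrangement_le hA measurableSet_Icc g).trans hgN
  have hfE : B (rearrangement μ (E.indicator f)) ≤ DB' * (M * N + N) := by
    rw [← hBB' _ (hf.indicator₀ hEm)]
    calc B' (E.indicator f) ≤ B' (fun x => E.indicator g x + h x) := by
          refine hB'.mono _ _ (hf.indicator₀ hEm) ((hg.indicator₀ hEm).add hh) ?_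
          filter_upwards [hfgh] with x hx
          by_cases hxE : x ∈ E
          · simpa [hxE] using hx
          · simp [hxE]
      _ ≤ DB' * (B' (E.indicator g) + B' h) := hDB' _ _ (hg.indicator₀ hEm) hh
      _ ≤ DB' * (M * N + N) := by
          gcongr
          exact le_add_self
  have hlocal : B ((Icc 0 1).indicator (rearrangement μ f)) ≤
      DB * (DB' * (M * N + N) + LB * ((KA + KB) * N)) := by
    refine (hB.mono _ _ (aemeasurable_indicator_rearrangement measurableSet_Icc _ _)
      ((aemeasurable_rearrangement _ _).add (aemeasurable_indicator_const measurableSet_Icc _))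
      (ae_of_all _ (indicator_Icc_rearrangement_le f))).trans ?_
    refine (hDB _ _ (aemeasurable_rearrangement _ _)
      (aemeasurable_indicator_const measurableSet_Icc _)).trans ?_
    gcongr
    exact (hLB c).trans (by gcongr)
  -- Capping at `c` removes the local part of `h`, about which `A` knows nothing; the tail passes
  -- from `B` to `A` by the global comparison.
  have hmin : A' (fun x => min (h x) c) ≤
      DA * (LA * ((KA + KB) * N) + M' * (N + KB * N)) := by
    rw [hAA' _ (hh.min aemeasurable_const)]
    refine (hA.mono _ _ (aemeasurable_rearrangement _ _)
      ((aemeasurable_indicator_const measurableSet_Icc _).add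
        (aemeasurable_indicator_rearrangement measurableSet_Ioi _ _))
      (rearrangement_le_of_le_const (fun x => min_le_right _ _)
        (ae_of_all _ fun x => min_le_left _ _))).trans ?_
    refine (hDA _ _ (aemeasurable_indicator_const measurableSet_Icc _)
      (aemeasurable_indicator_rearrangement measurableSet_Ioi _ _)).trans ?_
    gcongr
    · exact (hLA c).trans (by gcongr)
    · refine (hM' _ (rearrangement_antitone μ h)).trans ?_
      gcongr
      · exact (apply_indicator_rearrangement_le hB measurableSet_Ioi h).trans hhN
      · exact (rearrangement_antitone μ h (by norm_num)).trans hhhalf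
  have hglobal : A ((Ioi 1).indicator (rearrangement μ f)) ≤
      DA' * (N + DA * (LA * ((KA + KB) * N) + M' * (N + KB * N))) := by
    calc A ((Ioi 1).indicator (rearrangement μ f))
        ≤ A (rearrangement μ fun x => min (f x) c) :=
          hA.mono _ _ (aemeasurable_indicator_rearrangement measurableSet_Ioi _ _)
            (aemeasurable_rearrangement _ _) (ae_of_all _ (indicator_Ioi_rearrangement_le f))
      _ = A' (fun x => min (f x) c) := (hAA' _ (hf.min aemeasurable_const)).symm
      _ ≤ A' (fun x => g x + min (h x) c) := by
          refine hA'.mono _ _ (hf.min aemeasurable_const)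
            (hg.add (hh.min aemeasurable_const)) ?_
          filter_upwards [hfgh] with x hx
          rw [← min_add_add_left]
          exact le_min ((min_le_left _ _).trans hx) ((min_le_right _ _).trans le_add_self)
      _ ≤ DA' * (A' g + A' fun x => min (h x) c) := hDA' _ _ hg (hh.min aemeasurable_const)
      _ ≤ _ := by
          gcongr
          exact le_self_add
  refine (add_le_add hlocal hglobal).trans (le_of_eq ?_)
  push_cast
  ring

theorem wlNorm_le_sumNorm (𝕜 : Type*) [RCLike 𝕜] (hA : IsQuasiBanachFunctionNorm halfLine A)
    (hB : IsQuasiBanachFunctionNorm halfLine B) (hA' : IsQuasiBanachFunctionNorm μ A')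
    (hB' : IsQuasiBanachFunctionNorm μ B') (hAA' : Represents μ A A') (hBB' : Represents μ B B')
    (hloc : LocalStronger A B) (hglob : GlobalStronger B A) :
    ∃ C : ℝ≥0, ∀ f : R → 𝕜, AEStronglyMeasurable f μ →
      wlNorm μ B A f ≤ C * sumNorm μ A' B' f := by
  obtain ⟨C, hC⟩ := exists_wl_le_of_le_add hA hB hA' hB' hAA' hBB' hloc hglob
  -- A nonzero constant is needed to divide by it and so reach the infimum over decompositions.
  refine ⟨C + 1, fun f hf => ?_⟩
  rw [mul_comm, ← ENNReal.div_le_iff_le_mul (Or.inl (by simp)) (Or.inl ENNReal.coe_ne_top)]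
  refine le_sInf ?_
  rintro r ⟨g, h, hg, hh, hfgh, rfl⟩
  rw [ENNReal.div_le_iff_le_mul (Or.inl (by simp)) (Or.inl ENNReal.coe_ne_top), mul_comm]
  refine (hC _ _ _ hf.enorm hg.enorm hh.enorm ?_).trans (by gcongr; exact le_self_add)
  filter_upwards [hfgh] with x hx
  rw [hx]
  exact enorm_add_le _ _

theorem sumNorm_comm {𝕜 : Type*} [RCLike 𝕜] (f : R → 𝕜) :
    sumNorm μ A' B' f = sumNorm μ B' A' f := by
  have key : ∀ A' B' : (R → ℝ≥0∞) → ℝ≥0∞, sumNorm μ A' B' f ≤ sumNorm μ B' A' f := by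
    intro A' B'
    refine le_sInf ?_
    rintro r ⟨g, h, hg, hh, hfgh, rfl⟩
    exact sInf_le ⟨h, g, hh, hg, by rwa [add_comm], add_comm _ _⟩
  exact le_antisymm (key _ _) (key _ _)

section Embeddings

variable {𝕜 : Type*} [RCLike 𝕜] {N₁ N₂ : (R → 𝕜) → ℝ≥0∞}

theorem embeds_of_le (h : ∃ C : ℝ≥0, ∀ f, AEStronglyMeasurable f μ → N₂ f ≤ C * N₁ f) :
    Embeds μ N₁ N₂ := by
  obtain ⟨C, hC⟩ := h
  exact ⟨fun f hf => ⟨hf.1, (hC f hf.1).trans_lt (ENNReal.mul_lt_top ENNReal.coe_lt_top hf.2)⟩,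
    C, fun f hf => hC f hf.1⟩

theorem eqEquivNorms_of_le (h₁ : ∃ C : ℝ≥0, ∀ f, AEStronglyMeasurable f μ → N₁ f ≤ C * N₂ f)
    (h₂ : ∃ C : ℝ≥0, ∀ f, AEStronglyMeasurable f μ → N₂ f ≤ C * N₁ f) :
    EqEquivNorms μ N₁ N₂ := by
  refine ⟨(embeds_of_le h₂).1.antisymm (embeds_of_le h₁).1, ?_⟩
  obtain ⟨C₁, hC₁⟩ := h₁
  obtain ⟨C₂, hC₂⟩ := h₂
  refine ⟨C₁ + C₂, fun f hf => ⟨(hC₁ f hf.1).trans ?_, (hC₂ f hf.1).trans ?_⟩⟩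
  · gcongr
    exact le_self_add
  · gcongr
    exact le_add_self

end Embeddings

theorem amalgam_embeddings (𝕜 : Type*) [RCLike 𝕜] (hA : IsQuasiBanachFunctionNorm halfLine A)
    (hB : IsQuasiBanachFunctionNorm halfLine B) (hA' : IsQuasiBanachFunctionNorm μ A')
    (hB' : IsQuasiBanachFunctionNorm μ B') (hAA' : Represents μ A A')
    (hBB' : Represents μ B B') :
    Embeds (𝕜 := 𝕜) μ (interNorm A' B') (wlNorm μ A B) ∧
      Embeds (𝕜 := 𝕜) μ (wlNorm μ A B) (sumNorm μ A' B') ∧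
      (LocalStronger A B → GlobalStronger B A →
        EqEquivNorms (𝕜 := 𝕜) μ (interNorm A' B') (wlNorm μ A B) ∧
        EqEquivNorms (𝕜 := 𝕜) μ (sumNorm μ A' B') (wlNorm μ B A)) := by
  have hinter : ∃ C : ℝ≥0, ∀ f : R → 𝕜, AEStronglyMeasurable f μ →
      wlNorm μ A B f ≤ C * interNorm A' B' f :=
    ⟨2, fun f hf => wlNorm_le_interNorm hA hB hAA' hBB' hf⟩
  refine ⟨embeds_of_le hinter, embeds_of_le (sumNorm_le_wlNorm 𝕜 hA hB hAA' hBB'),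
    fun hloc hglob => ⟨eqEquivNorms_of_le
      (interNorm_le_wlNorm 𝕜 hA hB hAA' hBB' hloc hglob) hinter,
      eqEquivNorms_of_le ?_ (wlNorm_le_sumNorm 𝕜 hA hB hA' hB' hAA' hBB' hloc hglob)⟩⟩
  -- `sumNorm_le_wlNorm` uses no comparison hypothesis, so it also holds with `A` and `B` exchanged.
  simp_rw [fun f : R → 𝕜 => sumNorm_comm (μ := μ) (A' := A') (B' := B') f]
  exact sumNorm_le_wlNorm 𝕜 hB hA hBB' hAA'

theorem represents_self (hA : IsRIQuasiBanachFunctionNorm halfLine A) :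
    Represents halfLine A A := fun f hf =>
  hA.rearrangement_invariant _ _ hf (aemeasurable_rearrangement _ _)
    (rearrangement_rearrangement halfLine f).symm

end WienerLuxemburg


open WienerLuxemburg in
/-- The first conjunct is the theorem for spaces over the half-line; the second one is the theorem
over a measure space `(R, μ)`, for norms `A'`, `B'` represented by the norms `A`, `B` on the half-line
through which the amalgams are defined. -/
theorem theorem2p1 (𝕜 : Type*) [RCLike 𝕜] (A B : (ℝ → ℝ≥0∞) → ℝ≥0∞)
    (hA : IsRIQuasiBanachFunctionNorm halfLine A) (hB : IsRIQuasiBanachFunctionNorm halfLine B) :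
    (Embeds (𝕜 := 𝕜) halfLine (interNorm A B) (wlNorm halfLine A B) ∧
      Embeds (𝕜 := 𝕜) halfLine (wlNorm halfLine A B) (sumNorm halfLine A B) ∧
      (LocalStronger A B → GlobalStronger B A →
        EqEquivNorms (𝕜 := 𝕜) halfLine (interNorm A B) (wlNorm halfLine A B) ∧
        EqEquivNorms (𝕜 := 𝕜) halfLine (sumNorm halfLine A B) (wlNorm halfLine B A))) ∧
    (∀ (R : Type*) [MeasurableSpace R] (μ : Measure R) [SigmaFinite μ]
      (A' B' : (R → ℝ≥0∞) → ℝ≥0∞),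
      IsRIQuasiBanachFunctionNorm μ A' → IsRIQuasiBanachFunctionNorm μ B' →
      Represents μ A A' → Represents μ B B' →
      Embeds (𝕜 := 𝕜) μ (interNorm A' B') (wlNorm μ A B) ∧
      Embeds (𝕜 := 𝕜) μ (wlNorm μ A B) (sumNorm μ A' B') ∧
      (LocalStronger A B → GlobalStronger B A →
        EqEquivNorms (𝕜 := 𝕜) μ (interNorm A' B') (wlNorm μ A B) ∧
        EqEquivNorms (𝕜 := 𝕜) μ (sumNorm μ A' B') (wlNorm μ B A))) := by
  refine ⟨amalgam_embeddings 𝕜 hA.1 hB.1 hA.1 hB.1 (represents_self hA) (represents_self hB), ?_⟩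
  intro R _ μ _ A' B' hA' hB' hAA' hBB'
  exact amalgam_embeddings 𝕜 hA.1 hB.1 hA'.1 hB'.1 hAA' hBB'
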